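/- Let $n\ge 1$. For $f\in\mathcal S(\mathbb R^{2n})$, written $f(x,u)$ with $x,u\in\mathbb R^n$, let $$Pf(\alpha,\bar x)=|\alpha|^{-n}\int_{\mathbb R^n} f\big(\tfrac1\alpha\bar x+(1-\tfrac1\alpha)u,\,u\big)\,du\quad(\alpha\ne 0),\qquad Pf(0,\bar x)=\int_{\mathbb R^n} f(x,\bar x)\,dx ,$$ and $P^*g(x,u)=\int_{\mathbb R} g(\alpha,\alpha x+(1-\alpha)u)\,d\alpha$. Let $\Omega$ be the set of $(x,u)\in\mathbb R^{2n}$ with $(x_i,u_i)\neq(0,0)$ for all $i$, let $\phi_i=\arg(x_i,u_i)\in[0,2\pi)$, and fix $j\in\{1,\dots,n\}$. (a) The product $\prod_{i\ne j}\delta(\sin(\phi_j-\phi_i))$ (equal to $1$ if $n=1$) is a well-defined measure on $\Omega$: there is exactly one Borel measure $\delta_j$ on $\mathbb R^{2n}$, carried by $\Omega$ and finite on compact subsets of $\Omega$, such that $$\int \varphi\,d\delta_j=\lim_{\varepsilon\to0^+}\int_{\mathbb R^{2n}}\varepsilon^{-(n-1)}\rho\Big(\tfrac1\varepsilon\big(\sin(\phi_j-\phi_i)\big)_{i\ne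 j}\Big)\varphi(x,u)\,dx\,du$$ for all continuous $\varphi$ with compact support contained in $\Omega$ and all continuous compactly supported $\rho$ on $\mathbb R^{n-1}$ with $\int\rho=1$. (b) The normal operator is convolution with the kernel $$K_j=\frac{|x_j-u_j|^{n-2}\prod_{i\neq j}\delta(\sin(\phi_j-\phi_i))}{\|(x_j,u_j)\|^{n-1}\prod_{i\ne j}\|(x_i,u_i)\|},$$ where $K_j$ is the measure whose density with respect to $\delta_j$ is the remaining factor and $(K_j*f)(z)=\int f(z-y)\,dK_j(y)$. That is, for every $f\in\mathcal S(\mathbb R^{2n})$ (complex-valued) and $z\in\mathbb R^{2n}$: - $P^*P|f|(z)=(K_j*|f|)(z)$ as elements of $[0,\infty]$; - whenever this value is finite, the integral defining $P^*Pf(z)$ converges absolutely and $P^*Pf(z)=(K_j*f)(z)$; - if $n\ge2$, it is finite for all $f$ and $z$, so $P^*Pf=K_j*f$ everywhere on $\mathbb R^{2n}$. (c) For $n=1$ this reads $P^*Pf=|x_1-u_1|^{-1}*f$ (convolution of functions on $\mathbb R^2$), in the same sense: $P^*P|f|(z)=(|x_1-u_1|^{-1}*|f|)(z)$ in $[0,\infty]$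 for all $f$ and $z$, and $P^*Pf(z)=(|x_1-u_1|^{-1}*f)(z)$, with both integrals absolutely convergent, whenever that value is finite. -/

import Mathlib

open MeasureTheory Filter Topology
open scoped Convolution SchwartzMap

/-- The `n`-dimensional photography transform.  For `α ≠ 0` it is
`Pf(α, x̄) = |α|⁻ⁿ ∫ f(x̄/α + (1 - 1/α) u, u) du`; at `α = 0` it is extended by the coupled Radon
transform, `Pf(0, x̄) = ∫∫ f(x, u) δ(u - x̄) dx du = ∫ f(x, x̄) dx`.
A point of `ℝⁿ × ℝⁿ` is a pair `(x, u)`; the measure is Lebesgue measure. -/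
noncomputable def photographyTransform {n : ℕ} {V : Type*} [NormedAddCommGroup V]
    [NormedSpace ℝ V] (f : (Fin n → ℝ) × (Fin n → ℝ) → V) (α : ℝ) (xbar : Fin n → ℝ) : V :=
  if α = 0 then ∫ x : Fin n → ℝ, f (x, xbar)
  else (|α| ^ n)⁻¹ • ∫ u : Fin n → ℝ, f (α⁻¹ • xbar + (1 - α⁻¹) • u, u)

/-- The dual operator `P* g(x, u) = ∫ g(α, α x + (1 - α) u) dα`. -/
noncomputable def dualPhotographyTransform {n : ℕ} {V : Type*} [NormedAddCommGroup V]
    [NormedSpace ℝ V] (g : ℝ → (Fin n → ℝ) → V) (z : (Fin n → ℝ) × (Fin n → ℝ)) : V :=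
  ∫ α : ℝ, g α (α • z.1 + (1 - α) • z.2)

/-- The principal argument in `[0, 2π)` of a point `(a, b)` of the plane. -/
noncomputable def principalArg (a b : ℝ) : ℝ :=
  toIcoMod Real.two_pi_pos 0 (Complex.arg ⟨a, b⟩)

/-- The Euclidean norm `‖(xᵢ, uᵢ)‖` of the `i`-th pair of coordinates. -/
noncomputable def pairNorm {n : ℕ} (y : (Fin n → ℝ) × (Fin n → ℝ)) (i : Fin n) : ℝ :=
  Real.sqrt (y.1 i ^ 2 + y.2 i ^ 2)

/-- The open set on which all the arguments `arg(xᵢ, uᵢ)` are defined. -/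
def pairsNonzero (n : ℕ) : Set ((Fin n → ℝ) × (Fin n → ℝ)) :=
  {y | ∀ i, (y.1 i, y.2 i) ≠ ((0 : ℝ), (0 : ℝ))}

/-- The map `(x, u) ↦ (sin(φⱼ - φᵢ))_{i ≠ j}` with `φᵢ = arg(xᵢ, uᵢ)`. -/
noncomputable def sinArgDiff {n : ℕ} (j : Fin n) (y : (Fin n → ℝ) × (Fin n → ℝ)) :
    {i : Fin n // i ≠ j} → ℝ :=
  fun i => Real.sin (principalArg (y.1 j) (y.2 j) - principalArg (y.1 i) (y.2 i))

/-- The function part of the convolution kernel,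
`|xⱼ - uⱼ|ⁿ⁻² / (‖(xⱼ, uⱼ)‖ⁿ⁻¹ ∏_{i ≠ j} ‖(xᵢ, uᵢ)‖)`. -/
noncomputable def kernelWeight {n : ℕ} (j : Fin n) (y : (Fin n → ℝ) × (Fin n → ℝ)) : ℝ :=
  |y.1 j - y.2 j| ^ ((n : ℤ) - 2) /
    (pairNorm y j ^ (n - 1) * ∏ i ∈ Finset.univ.erase j, pairNorm y i)

/-- `μ` is the composed delta function `∏ᵢ δ(gᵢ) = δ ∘ g` of a map `g` into `ℝ^ι` on the open set
`Ω`: a measure carried by `Ω`, finite on the compact subsets of `Ω`, which is the weak limit on `Ω`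
of `ε^{-|ι|} ρ(g(·)/ε)` as `ε → 0+`, for every continuous compactly supported `ρ` on `ℝ^ι` with
integral one (so `ε^{-|ι|} ρ(·/ε)` tends to `δ`).  If `ι` is empty, this is Lebesgue measure
on `Ω`. -/
structure IsDeltaComp {X ι : Type*} [TopologicalSpace X] [MeasureSpace X] [Fintype ι]
    (Ω : Set X) (g : X → ι → ℝ) (μ : Measure X) : Prop where
  compl_null : μ Ωᶜ = 0
  finite_on_compacts : ∀ K : Set X, IsCompact K → K ⊆ Ω → μ K < ⊤
  tendsto : ∀ ρ : (ι → ℝ) → ℝ, Continuous ρ → HasCompactSupport ρ → ∫ t, ρ t = 1 →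
    ∀ φ : X → ℝ, Continuous φ → HasCompactSupport φ → tsupport φ ⊆ Ω →
      Tendsto (fun ε : ℝ => ∫ y, ((ε ^ Fintype.card ι)⁻¹ * ρ (ε⁻¹ • g y)) * φ y)
        (𝓝[>] 0) (𝓝 (∫ y, φ y ∂μ))

/-!
Substituting in the definitions, `P* P f(z) = ∫ |α|⁻ⁿ ∫ f(z - ((1 - 1/α) w, w)) dw dα`, so the
normal operator is convolution with the image `κ` of `|α|⁻ⁿ dα dw` under
`(α, w) ↦ ((1 - 1/α) w, w)`. This measure lives on the points all of whose pairs `(xᵢ, uᵢ)` are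
proportional, where all the sines vanish.

Regard the pairs as complex numbers, `zᵢ = xᵢ + I uᵢ`, and use `p = zⱼ` and `wᵢ = zᵢ / zⱼ` as
coordinates; then `dz = ‖p‖^{2(n-1)} dp dw` and `sin(φⱼ - φᵢ) = -Im wᵢ / ‖wᵢ‖`. With
`wᵢ = τᵢ - I ε |τᵢ| σᵢ` the sines are `ε σᵢ / √(1 + ε² σᵢ²)` and `dw = ε^{n-1} ∏ |τᵢ| dτ dσ`, so
as `ε → 0` dominated convergence gives the measure `‖p‖^{2(n-1)} ∏ |τᵢ| dp dτ` at the points with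
pairs `p` and `τᵢ p`. Multiplying by the weight of the kernel leaves `|Re p - Im p|^{n-2} dp dτ`,
and this is `κ` under `p = ((1 - 1/α) b, b)`, `b = wⱼ`, `τᵢ = wᵢ / b`. For `n ≥ 2` the measure `κ`
integrates `(1 + ‖y‖)⁻ʳ` when `r > n`, because the inner integral is `O(max(1, |1 - 1/α|)⁻ⁿ)`.
-/

open Asymptotics
open scoped ENNReal

section ChangeOfVariables

theorem lintegral_eq_abs_det_mul_lintegral_comp {E : Type*} [NormedAddCommGroup E]
    [NormedSpace ℝ E] [FiniteDimensional ℝ E] [MeasurableSpace E] [BorelSpace E] (μ : Measure E)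
    [μ.IsAddHaarMeasure] {A : E →ₗ[ℝ] E} (hA : LinearMap.det A ≠ 0) {h : E → ℝ≥0∞}
    (hh : Measurable h) :
    ∫⁻ x, h x ∂μ = ENNReal.ofReal |LinearMap.det A| * ∫⁻ x, h (A x) ∂μ := by
  rw [← lintegral_map hh A.continuous_of_finiteDimensional.measurable,
    Measure.map_linearMap_addHaar_eq_smul_addHaar μ hA, lintegral_smul_measure, smul_eq_mul,
    ← mul_assoc, ← ENNReal.ofReal_mul (abs_nonneg _), ← abs_mul, mul_inv_cancel₀ hA, abs_one,
    ENNReal.ofReal_one, one_mul]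

theorem lintegral_pi_eq_prod_abs_norm_mul {ι 𝕜 : Type*} [Fintype ι] [NormedField 𝕜]
    [NormedAlgebra ℝ 𝕜] [FiniteDimensional ℝ 𝕜] [MeasureSpace 𝕜] [BorelSpace 𝕜]
    [SecondCountableTopology 𝕜] [(volume : Measure 𝕜).IsAddHaarMeasure] {d : ι → 𝕜}
    (hd : ∀ i, d i ≠ 0) {h : (ι → 𝕜) → ℝ≥0∞} (hh : Measurable h) :
    ∫⁻ s, h s = ENNReal.ofReal (∏ i, |Algebra.norm ℝ (d i)|) * ∫⁻ s : ι → 𝕜, h (d * s) := by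
  have hdet : LinearMap.det (LinearMap.pi fun i =>
      (LinearMap.mul ℝ 𝕜 (d i)).comp (LinearMap.proj i)) = ∏ i, Algebra.norm ℝ (d i) := by
    simp only [LinearMap.det_pi, Algebra.norm_apply]
    rfl
  have hne : ∏ i, Algebra.norm ℝ (d i) ≠ 0 :=
    Finset.prod_ne_zero_iff.2 fun i _ => Algebra.norm_ne_zero_iff.2 (hd i)
  rw [lintegral_eq_abs_det_mul_lintegral_comp volume (hdet.trans_ne hne) hh, hdet, Finset.abs_prod]
  rfl

theorem lintegral_pi_eq_abs_norm_pow_mul {ι 𝕜 : Type*} [Fintype ι] [NormedField 𝕜]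
    [NormedAlgebra ℝ 𝕜] [FiniteDimensional ℝ 𝕜] [MeasureSpace 𝕜] [BorelSpace 𝕜]
    [SecondCountableTopology 𝕜] [(volume : Measure 𝕜).IsAddHaarMeasure] {d : 𝕜} (hd : d ≠ 0)
    {h : (ι → 𝕜) → ℝ≥0∞} (hh : Measurable h) :
    ∫⁻ s, h s =
      ENNReal.ofReal (|Algebra.norm ℝ d| ^ Fintype.card ι) * ∫⁻ s : ι → 𝕜, h (d • s) := by
  rw [lintegral_pi_eq_prod_abs_norm_mul (d := fun _ => d) (fun _ => hd) hh, Finset.prod_const,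
    Finset.card_univ]
  rfl

theorem lintegral_map_withDensity {α β : Type*} [MeasurableSpace α] [MeasurableSpace β]
    {μ : Measure α} {g : α → ℝ≥0∞} {Φ : α → β} {h : β → ℝ≥0∞} (hg : Measurable g)
    (hΦ : Measurable Φ) (hh : Measurable h) :
    ∫⁻ y, h y ∂(μ.withDensity g).map Φ = ∫⁻ x, g x * h (Φ x) ∂μ := by
  rw [lintegral_map hh hΦ]
  exact lintegral_withDensity_eq_lintegral_mul μ hg (hh.comp hΦ)

theorem measurePreserving_funSplitAt_symm {ι β : Type*} [Fintype ι] [DecidableEq ι] [MeasureSpace β]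
    [SigmaFinite (volume : Measure β)] (j : ι) :
    MeasurePreserving (Equiv.funSplitAt j β).symm := by
  let _ : Fintype {k : ι // k = j} := Subtype.fintype fun k => k = j
  have h1 := (volume_preserving_piEquivPiSubtypeProd (fun _ : ι => β) (fun k => k = j)).symm
  have h2 : MeasurePreserving (Prod.map
      (MeasurableEquiv.piUnique fun _ : {k : ι // k = j} => β).symm
      (id : ({i : ι // i ≠ j} → β) → _)) volume volume :=
    (volume_preserving_piUnique fun _ => β).symm.prod (MeasurePreserving.id volume)
  have heq : (Equiv.funSplitAt j β).symm =
      (MeasurableEquiv.piEquivPiSubtypeProd (fun _ => β) (fun k => k = j)).symm ∘ Prod.map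
        (MeasurableEquiv.piUnique fun _ : {k : ι // k = j} => β).symm id := by
    funext q k
    by_cases hk : k = j
    · subst hk; simp
    · simp [hk]
  exact heq ▸ h1.comp h2

theorem lintegral_complex_eq {h : ℂ → ℝ≥0∞} (hh : Measurable h) :
    ∫⁻ p, h p = ∫⁻ b : ℝ, ∫⁻ a : ℝ, h ⟨a, b⟩ := by
  have hm : Measurable fun x : ℝ × ℝ => h (Complex.measurableEquivRealProd.symm x) :=
    hh.comp Complex.measurableEquivRealProd.symm.measurable
  rw [← Complex.volume_preserving_equiv_real_prod.symm.lintegral_comp hh, Measure.volume_eq_prod,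
    lintegral_prod_symm _ hm.aemeasurable]
  rfl

theorem lintegral_eq_lintegral_one_sub_inv_mul {b : ℝ} (hb : b ≠ 0) (h : ℝ → ℝ≥0∞) :
    ∫⁻ a, h a = ∫⁻ α, ENNReal.ofReal (|b| / α ^ 2) * h ((1 - α⁻¹) * b) := by
  have himage : (fun α : ℝ => (1 - α⁻¹) * b) '' {0}ᶜ = {b}ᶜ := by
    ext a
    simp only [Set.mem_image, Set.mem_compl_iff, Set.mem_singleton_iff]
    refine ⟨?_, fun ha => ?_⟩
    · rintro ⟨α, hα, rfl⟩ h
      simp [hα, hb] at h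
    · have hab : b - a ≠ 0 := sub_ne_zero.2 (Ne.symm ha)
      refine ⟨b / (b - a), div_ne_zero hb hab, ?_⟩
      field_simp
      ring
  have hinj : Set.InjOn (fun α : ℝ => (1 - α⁻¹) * b) {0}ᶜ := fun x _ y _ h =>
    inv_injective (sub_right_injective (mul_right_cancel₀ hb h))
  have hderiv : ∀ α ∈ ({0}ᶜ : Set ℝ),
      HasDerivWithinAt (fun α : ℝ => (1 - α⁻¹) * b) (b / α ^ 2) {0}ᶜ α := fun α hα => by
    have h1 := ((hasDerivAt_inv (show α ≠ 0 from hα)).const_sub 1).mul_const b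
    exact h1.hasDerivWithinAt.congr_deriv (by rw [neg_neg, inv_mul_eq_div])
  have key := lintegral_image_eq_lintegral_abs_deriv_mul
    (measurableSet_singleton (0 : ℝ)).compl hderiv hinj h
  rw [himage, restrict_compl_singleton, restrict_compl_singleton] at key
  simpa only [abs_div, abs_pow, sq_abs] using key

end ChangeOfVariables

section DeltaComp

variable {X : Type*} [TopologicalSpace X]

theorem measure_eq_of_integral_eq_of_tsupport_subset [T2Space X]
    [LocallyCompactSpace X] [SecondCountableTopology X] [MeasurableSpace X] [BorelSpace X]
    {Ω : Set X} (hΩ : IsOpen Ω) {μ ν : Measure X} (hμ0 : μ Ωᶜ = 0) (hν0 : ν Ωᶜ = 0)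
    (hμ : ∀ K, IsCompact K → K ⊆ Ω → μ K < ⊤) (hν : ∀ K, IsCompact K → K ⊆ Ω → ν K < ⊤)
    (h : ∀ φ : X → ℝ, Continuous φ → HasCompactSupport φ → tsupport φ ⊆ Ω →
      ∫ y, φ y ∂μ = ∫ y, φ y ∂ν) : μ = ν := by
  have hemb : MeasurableEmbedding ((↑) : Ω → X) := .subtype_coe hΩ.measurableSet
  have hmap {κ : Measure X} (hκ : κ Ωᶜ = 0) : (κ.comap ((↑) : Ω → X)).map (↑) = κ := by
    rw [hemb.map_comap, Subtype.range_coe]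
    exact Measure.restrict_eq_self_of_ae_mem
      ((measure_eq_zero_iff_ae_notMem.1 hκ).mono fun _ => not_not.1)
  have hfin {κ : Measure X} (hκ : ∀ K, IsCompact K → K ⊆ Ω → κ K < ⊤) :
      IsFiniteMeasureOnCompacts (κ.comap ((↑) : Ω → X)) := ⟨fun K hK => by
    rw [hemb.comap_apply]
    exact hκ _ (hK.image continuous_subtype_val) (Subtype.coe_image_subset _ _)⟩
  have := hΩ.locallyCompactSpace
  have := hfin hμ
  have := hfin hν
  rw [← hmap hμ0, ← hmap hν0]
  congr 1
  refine Measure.ext_of_integral_eq_on_compactlySupported fun f => ?_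
  have htsupp : tsupport (Function.extend (↑) f 0 : X → ℝ) ⊆ (↑) '' tsupport f :=
    f.hasCompactSupport.tsupport_extend_zero_subset continuous_subtype_val
  have key := h (Function.extend (↑) f 0)
    (f.hasCompactSupport.continuous_extend_zero hΩ f.continuous)
    (f.hasCompactSupport.extend_zero continuous_subtype_val)
    (htsupp.trans (Subtype.coe_image_subset _ _))
  rw [← hmap hμ0, ← hmap hν0, hemb.integral_map, hemb.integral_map] at key
  simpa only [Subtype.val_injective.extend_apply] using key

variable [MeasureSpace X] {ι : Type*} [Fintype ι] {Ω : Set X} {g : X → ι → ℝ}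

theorem IsDeltaComp.unique [T2Space X] [LocallyCompactSpace X] [SecondCountableTopology X]
    [BorelSpace X] (hΩ : IsOpen Ω) {μ ν : Measure X} (hμ : IsDeltaComp Ω g μ)
    (hν : IsDeltaComp Ω g ν) : μ = ν := by
  let b : ContDiffBump (0 : ι → ℝ) := ⟨1, 2, one_pos, one_lt_two⟩
  refine measure_eq_of_integral_eq_of_tsupport_subset hΩ hμ.compl_null hν.compl_null
    hμ.finite_on_compacts hν.finite_on_compacts fun φ hφ hφc hφΩ => ?_
  have hlim {κ : Measure X} (hκ : IsDeltaComp Ω g κ) := hκ.tendsto (b.normed volume)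
    b.continuous_normed b.hasCompactSupport_normed b.integral_normed φ hφ hφc hφΩ
  exact tendsto_nhds_unique (hlim hμ) (hlim hν)

theorem isDeltaComp_volume_of_isEmpty [IsEmpty ι] [IsFiniteMeasureOnCompacts (volume : Measure X)]
    (hΩ : volume Ωᶜ = 0) : IsDeltaComp Ω g volume where
  compl_null := hΩ
  finite_on_compacts _ hK _ := hK.measure_lt_top
  tendsto ρ _ _ hρ φ _ _ _ := by
    have hρ1 (t : ι → ℝ) : ρ t = 1 := by
      rw [← hρ, integral_unique, Subsingleton.elim t default]
      simpa [volume_pi, measureReal_def] using congrArg ρ (Subsingleton.elim _ _)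
    simp [hρ1]

end DeltaComp

section ComplexCoordinates

theorem ae_pi_forall_ne (ι : Type*) [Fintype ι] {β : Type*} [MeasureSpace β]
    [SigmaFinite (volume : Measure β)] [NullSingletonClass (volume : Measure β)] (c : β) :
    ∀ᵐ y : ι → β, ∀ i, y i ≠ c :=
  ae_all_iff.2 fun i => Measure.ae_eval_ne (μ := fun _ : ι => (volume : Measure β)) i c

/-- The identification of `ℂ^ι` with `ℝ^ι × ℝ^ι` in which `zᵢ = xᵢ + I uᵢ`, so that `‖zᵢ‖` and
`arg zᵢ` are the radius and the angle of the pair `(xᵢ, uᵢ)`. -/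
def complexPairs (ι : Type*) : (ι → ℂ) ≃ₜ (ι → ℝ) × (ι → ℝ) where
  toFun z := (fun i => (z i).re, fun i => (z i).im)
  invFun y i := ⟨y.1 i, y.2 i⟩
  left_inv _ := rfl
  right_inv _ := rfl
  continuous_toFun := by fun_prop
  continuous_invFun := continuous_pi fun i => Complex.equivRealProdCLM.symm.continuous.comp
    (by fun_prop : Continuous fun y : (ι → ℝ) × (ι → ℝ) => (y.1 i, y.2 i))

theorem measurePreserving_complexPairs (ι : Type*) [Fintype ι] :
    MeasurePreserving (complexPairs ι) :=
  (volume_measurePreserving_arrowProdEquivProdArrow ℝ ℝ ι).comp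
    (volume_preserving_pi fun _ : ι => Complex.volume_preserving_equiv_real_prod)

variable {n : ℕ}

theorem pairNorm_complexPairs (z : Fin n → ℂ) (i : Fin n) :
    pairNorm (complexPairs (Fin n) z) i = ‖z i‖ := by
  rw [pairNorm, Complex.norm_eq_sqrt_sq_add_sq]
  rfl

theorem complexPairs_mem_pairsNonzero {z : Fin n → ℂ} :
    complexPairs (Fin n) z ∈ pairsNonzero n ↔ ∀ i, z i ≠ 0 :=
  forall_congr' fun i => not_congr <| by
    rw [Prod.mk.injEq, Complex.ext_iff]
    rfl

theorem isOpen_pairsNonzero (n : ℕ) : IsOpen (pairsNonzero n) := by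
  simp only [pairsNonzero, Set.ofPred_forall]
  exact isOpen_iInter_of_finite fun i => isOpen_ne.preimage (by fun_prop)

theorem volume_compl_pairsNonzero (n : ℕ) : volume (pairsNonzero n)ᶜ = 0 := by
  rw [← (measurePreserving_complexPairs (Fin n)).measure_preimage
    (isOpen_pairsNonzero n).measurableSet.compl.nullMeasurableSet, measure_eq_zero_iff_ae_notMem]
  filter_upwards [ae_pi_forall_ne (Fin n) (0 : ℂ)] with z hz
  exact not_not.2 (complexPairs_mem_pairsNonzero.2 hz)

theorem sinArgDiff_eq_sin_arg_sub (j : Fin n) (y : (Fin n → ℝ) × (Fin n → ℝ))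
    (i : {i : Fin n // i ≠ j}) :
    sinArgDiff j y i = Real.sin (Complex.arg ⟨y.1 j, y.2 j⟩ - Complex.arg ⟨y.1 i, y.2 i⟩) := by
  simp only [sinArgDiff, principalArg, ← Real.Angle.sin_coe, Real.Angle.coe_sub,
    Real.Angle.coe_toIcoMod]

theorem measurable_sinArgDiff (j : Fin n) : Measurable (sinArgDiff j) := by
  have harg (k : Fin n) :
      Measurable fun y : (Fin n → ℝ) × (Fin n → ℝ) => Complex.arg ⟨y.1 k, y.2 k⟩ :=
    Complex.measurable_arg.comp
      ((continuous_apply k).comp (complexPairs (Fin n)).symm.continuous).measurable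
  refine measurable_pi_lambda _ fun i => ?_
  simp only [sinArgDiff_eq_sin_arg_sub]
  exact Real.measurable_sin.comp ((harg j).sub (harg i))

theorem sinArgDiff_complexPairs {j : Fin n} {z : Fin n → ℂ} {i : {i : Fin n // i ≠ j}}
    (hj : z j ≠ 0) (hi : z i ≠ 0) :
    sinArgDiff j (complexPairs (Fin n) z) i = (z j / z i).im / ‖z j / z i‖ := by
  rw [sinArgDiff_eq_sin_arg_sub, ← Real.Angle.sin_coe, Real.Angle.coe_sub]
  change ((Complex.arg (z j) : Real.Angle) - Complex.arg (z i)).sin = _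
  rw [← Complex.arg_div_coe_angle hj hi, Real.Angle.sin_coe, Complex.sin_arg]

end ComplexCoordinates

section Frame

variable {n : ℕ}

/-- The point whose `j`-th pair of coordinates is the complex number `p` and whose other pairs are
the complex multiples `p wᵢ` of it; the `wᵢ` are real exactly when all pairs are proportional to the
`j`-th. -/
noncomputable def framePoint (j : Fin n) (q : ℂ × ({i : Fin n // i ≠ j} → ℂ)) :
    (Fin n → ℝ) × (Fin n → ℝ) :=
  complexPairs (Fin n) ((Equiv.funSplitAt j ℂ).symm (q.1, q.1 • q.2))

variable {j : Fin n}

theorem continuous_framePoint : Continuous (framePoint j) :=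
  (complexPairs (Fin n)).continuous.comp
    ((Homeomorph.funSplitAt ℂ j).symm.continuous.comp (by fun_prop))

theorem framePoint_mem_pairsNonzero {q : ℂ × ({i : Fin n // i ≠ j} → ℂ)} :
    framePoint j q ∈ pairsNonzero n ↔ q.1 ≠ 0 ∧ ∀ i, q.2 i ≠ 0 := by
  rw [framePoint, complexPairs_mem_pairsNonzero]
  refine ⟨fun h => ⟨by simpa using h j, fun i => ?_⟩, fun h i => ?_⟩
  · have hi := h i
    simp only [Equiv.funSplitAt_symm_apply, dif_neg i.2, Pi.smul_apply, smul_eq_mul] at hi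
    exact right_ne_zero_of_mul hi
  · by_cases hi : i = j
    · simpa [hi] using h.1
    · simpa [hi] using ⟨h.1, h.2 ⟨i, hi⟩⟩

theorem sinArgDiff_framePoint {p : ℂ} (hp : p ≠ 0) {w : {i : Fin n // i ≠ j} → ℂ}
    {i : {i : Fin n // i ≠ j}} (hi : w i ≠ 0) :
    sinArgDiff j (framePoint j (p, w)) i = -(w i).im / ‖w i‖ := by
  have hw : ‖w i‖ ≠ 0 := norm_ne_zero_iff.2 hi
  rw [framePoint, sinArgDiff_complexPairs (by simpa) (by simp [i.2, hp, hi])]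
  have hinv : (Equiv.funSplitAt j ℂ).symm (p, p • w) j /
      (Equiv.funSplitAt j ℂ).symm (p, p • w) i = (w i)⁻¹ := by
    simp [i.2, div_mul_cancel_left₀ hp]
  rw [hinv, Complex.inv_im, norm_inv, Complex.normSq_eq_norm_sq]
  field_simp

/-- The complex numbers `zⱼ` and `zᵢ / zⱼ` that describe a point in the frame of its `j`-th pair
(junk where `zⱼ = 0`). -/
noncomputable def frameCoord (j : Fin n) (y : (Fin n → ℝ) × (Fin n → ℝ)) :
    ℂ × ({i : Fin n // i ≠ j} → ℂ) :=
  ((complexPairs (Fin n)).symm y j,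
    fun i => (complexPairs (Fin n)).symm y i / (complexPairs (Fin n)).symm y j)

theorem frameCoord_framePoint {q : ℂ × ({i : Fin n // i ≠ j} → ℂ)} (hq : q.1 ≠ 0) :
    frameCoord j (framePoint j q) = q := by
  refine Prod.ext (by simp [frameCoord, framePoint]) (funext fun i => ?_)
  simp [frameCoord, framePoint, i.2, hq]

theorem continuousOn_frameCoord : ContinuousOn (frameCoord j) (pairsNonzero n) := by
  have hz (k : Fin n) : Continuous fun y => (complexPairs (Fin n)).symm y k :=
    (continuous_apply k).comp (complexPairs (Fin n)).symm.continuous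
  refine (hz j).continuousOn.prodMk (continuousOn_pi.2 fun i => (hz i).continuousOn.div
    (hz j).continuousOn fun y hy => ?_)
  exact complexPairs_mem_pairsNonzero.1 (((complexPairs (Fin n)).apply_symm_apply y).symm ▸ hy) j

theorem exists_norm_le_of_framePoint_mem {K : Set ((Fin n → ℝ) × (Fin n → ℝ))} (hK : IsCompact K)
    (hKΩ : K ⊆ pairsNonzero n) : ∃ R, ∀ q, framePoint j q ∈ K → ‖q‖ ≤ R := by
  obtain ⟨R, hR⟩ := hK.exists_bound_of_continuousOn (continuousOn_frameCoord.mono hKΩ)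
  refine ⟨R, fun q hq => ?_⟩
  have hq0 := (framePoint_mem_pairsNonzero.1 (hKΩ hq)).1
  exact frameCoord_framePoint hq0 ▸ hR _ hq

theorem lintegral_eq_lintegral_framePoint {h : (Fin n → ℝ) × (Fin n → ℝ) → ℝ≥0∞}
    (hh : Measurable h) :
    ∫⁻ y, h y = ∫⁻ p : ℂ, ENNReal.ofReal (‖p‖ ^ (2 * Fintype.card {i : Fin n // i ≠ j})) *
      ∫⁻ w, h (framePoint j (p, w)) := by
  have hsplit := (measurePreserving_complexPairs (Fin n)).comp (measurePreserving_funSplitAt_symm j)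
  have hm : Measurable fun q => h (complexPairs (Fin n) ((Equiv.funSplitAt j ℂ).symm q)) :=
    hh.comp hsplit.measurable
  rw [← hsplit.lintegral_comp hh, Measure.volume_eq_prod]
  refine (lintegral_prod _ hm.aemeasurable).trans
    (lintegral_congr_ae ((Measure.ae_ne volume (0 : ℂ)).mono fun p hp => ?_))
  dsimp only
  rw [lintegral_pi_eq_abs_norm_pow_mul hp
    (h := fun v => h (complexPairs (Fin n) ((Equiv.funSplitAt j ℂ).symm (p, v))))
    (hm.comp measurable_prodMk_left)]
  simp only [framePoint, Algebra.norm_complex_apply, Complex.normSq_eq_norm_sq, abs_pow, abs_norm,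
    pow_mul]

end Frame

section DeltaMeasure

variable {ι : Type*}

/-- The values of `ε⁻¹ sin(φⱼ - φᵢ)` at the point `tubePoint` with parameters `ε` and `σ`. -/
noncomputable def tubeSine (ε : ℝ) (σ : ι → ℝ) : ι → ℝ :=
  fun i => σ i / √(1 + ε ^ 2 * σ i ^ 2)

theorem tubeSine_zero (σ : ι → ℝ) : tubeSine 0 σ = σ := by
  funext i
  simp [tubeSine]

theorem continuous_tubeSine : Continuous fun x : ℝ × (ι → ℝ) => tubeSine x.1 x.2 :=
  continuous_pi fun i => Continuous.div (by fun_prop) (by fun_prop) fun x => by positivity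

variable [Fintype ι]

theorem norm_le_two_mul_of_norm_tubeSine_le {ε R : ℝ} (hε : 0 ≤ ε) (hR : ε * R ≤ 1 / 2)
    {σ : ι → ℝ} (h : ‖tubeSine ε σ‖ ≤ R) : ‖σ‖ ≤ 2 * R := by
  have hR0 : 0 ≤ R := (norm_nonneg _).trans h
  refine (pi_norm_le_iff_of_nonneg (by positivity)).2 fun i => ?_
  have hsqrt : 0 < √(1 + ε ^ 2 * σ i ^ 2) := Real.sqrt_pos.2 (by positivity)
  have hi : |σ i| ≤ R * √(1 + ε ^ 2 * σ i ^ 2) := by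
    rw [← div_le_iff₀ hsqrt, ← abs_of_pos hsqrt, ← abs_div]
    exact (norm_le_pi_norm (tubeSine ε σ) i).trans h
  have hsq := pow_le_pow_left₀ (abs_nonneg _) hi 2
  rw [sq_abs, mul_pow, Real.sq_sqrt (by positivity)] at hsq
  have hεR : (ε * R) ^ 2 ≤ (1 / 2) ^ 2 := pow_le_pow_left₀ (by positivity) hR 2
  exact abs_le_of_sq_le_sq (by nlinarith [mul_le_mul_of_nonneg_right hεR (sq_nonneg (σ i))])
    (by positivity)

/-- The measure `‖p‖^{2|ι|} ∏ᵢ |τᵢ| dp dτ` on the parameter space of the points with all pairs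
proportional: `p` is a pair and `τᵢ p` are the others. -/
noncomputable abbrev collinearMeasure (ι : Type*) [Fintype ι] : Measure (ℂ × (ι → ℝ)) :=
  volume.withDensity fun q =>
    ENNReal.ofReal (‖q.1‖ ^ (2 * Fintype.card ι)) * ENNReal.ofReal (∏ i, |q.2 i|)

instance : IsLocallyFiniteMeasure (collinearMeasure ι) := by
  simp only [collinearMeasure, ← ENNReal.ofReal_mul (pow_nonneg (norm_nonneg _) _)]
  exact IsLocallyFiniteMeasure.withDensity_ofReal (by fun_prop)

theorem ae_collinearMeasure_ne_zero : ∀ᵐ q ∂collinearMeasure ι, q.1 ≠ 0 ∧ ∀ i, q.2 i ≠ 0 :=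
  (withDensity_absolutelyContinuous _ _).ae_le (Eventually.and
    (Measure.quasiMeasurePreserving_fst.ae (Measure.ae_ne volume 0))
    (Measure.quasiMeasurePreserving_snd.ae (ae_pi_forall_ne ι 0)))

theorem lintegral_collinearMeasure {h : ℂ × (ι → ℝ) → ℝ≥0∞} (hh : Measurable h) :
    ∫⁻ q, h q ∂collinearMeasure ι = ∫⁻ p : ℂ, ENNReal.ofReal (‖p‖ ^ (2 * Fintype.card ι)) *
      ∫⁻ τ : ι → ℝ, ENNReal.ofReal (∏ i, |τ i|) * h (p, τ) := by
  have hτ : Measurable fun τ : ι → ℝ => ENNReal.ofReal (∏ i, |τ i|) :=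
    (by fun_prop : Continuous fun τ : ι → ℝ => ∏ i, |τ i|).measurable.ennreal_ofReal
  rw [collinearMeasure, lintegral_withDensity_eq_lintegral_mul _ (by fun_prop) hh,
    Measure.volume_eq_prod, lintegral_prod _ (by fun_prop)]
  refine lintegral_congr fun p => ?_
  simp only [Pi.mul_apply, mul_assoc]
  exact lintegral_const_mul _ (hτ.mul (hh.comp measurable_prodMk_left))

theorem lintegral_complex_pi_eq {ε : ℝ} (hε : 0 < ε) {h : (ι → ℂ) → ℝ≥0∞} (hh : Measurable h) :
    ∫⁻ w, h w = ENNReal.ofReal (ε ^ Fintype.card ι) * ∫⁻ τ : ι → ℝ,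
      ENNReal.ofReal (∏ i, |τ i|) * ∫⁻ σ : ι → ℝ, h fun i => ⟨τ i, -(ε * |τ i| * σ i)⟩ := by
  have hm : Measurable fun y => h ((complexPairs ι).symm y) :=
    hh.comp (complexPairs ι).symm.continuous.measurable
  rw [← lintegral_const_mul' _ _ ENNReal.ofReal_ne_top]
  calc ∫⁻ w, h w = ∫⁻ y, h ((complexPairs ι).symm y) :=
        (measurePreserving_complexPairs ι).lintegral_comp hm
    _ = ∫⁻ τ : ι → ℝ, ∫⁻ s : ι → ℝ, h fun i => ⟨τ i, s i⟩ :=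
        lintegral_prod _ hm.aemeasurable
    _ = _ := lintegral_congr_ae ((ae_pi_forall_ne ι 0).mono fun τ hτ => ?_)
  dsimp only
  rw [lintegral_pi_eq_prod_abs_norm_mul (d := fun i => -(ε * |τ i|))
    (h := fun s => h fun i => ⟨τ i, s i⟩)
    (fun i => neg_ne_zero.2 (mul_ne_zero hε.ne' (abs_ne_zero.2 (hτ i))))
    (hm.comp measurable_prodMk_left), ← mul_assoc, ← ENNReal.ofReal_mul (by positivity)]
  simp only [Algebra.norm_self, MonoidHom.id_apply, abs_neg, abs_mul, abs_abs, abs_of_pos hε,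
    Finset.prod_mul_distrib, Finset.prod_const, Finset.card_univ, Pi.mul_apply, neg_mul]

variable {n : ℕ} {j : Fin n}

/-- The point with `j`-th pair `p` and `i`-th pair `τᵢ p`. -/
noncomputable def collinearPoint (j : Fin n) (q : ℂ × ({i : Fin n // i ≠ j} → ℝ)) :
    (Fin n → ℝ) × (Fin n → ℝ) :=
  framePoint j (q.1, fun i => (q.2 i : ℂ))

theorem continuous_collinearPoint : Continuous (collinearPoint j) :=
  continuous_framePoint.comp (by fun_prop)

/-- The measure `∏_{i ≠ j} δ(sin(φⱼ - φᵢ))`, which lives on the points with all pairs proportional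
to the `j`-th. -/
noncomputable def deltaMeasure (j : Fin n) : Measure ((Fin n → ℝ) × (Fin n → ℝ)) :=
  (collinearMeasure {i : Fin n // i ≠ j}).map (collinearPoint j)

theorem deltaMeasure_compl_pairsNonzero : deltaMeasure j (pairsNonzero n)ᶜ = 0 := by
  rw [deltaMeasure, Measure.map_apply continuous_collinearPoint.measurable
    (isOpen_pairsNonzero n).measurableSet.compl, measure_eq_zero_iff_ae_notMem]
  filter_upwards [ae_collinearMeasure_ne_zero] with q hq
  exact not_not.2 (framePoint_mem_pairsNonzero.2 (hq.imp_right fun h i =>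
    Complex.ofReal_ne_zero.2 (h i)))

/-- The deformation of `collinearPoint` with `sin(φⱼ - φᵢ) = ε σᵢ / √(1 + ε² σᵢ²)`; it parametrizes
the neighbourhood of the proportional points on which `ρ(ε⁻¹ sin(φⱼ - φᵢ))` does not vanish. -/
noncomputable def tubePoint (j : Fin n) (ε : ℝ)
    (q : (ℂ × ({i : Fin n // i ≠ j} → ℝ)) × ({i : Fin n // i ≠ j} → ℝ)) :
    (Fin n → ℝ) × (Fin n → ℝ) :=
  framePoint j (q.1.1, fun i => ⟨q.1.2 i, -(ε * |q.1.2 i| * q.2 i)⟩)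

theorem tubePoint_zero (q : (ℂ × ({i : Fin n // i ≠ j} → ℝ)) × ({i : Fin n // i ≠ j} → ℝ)) :
    tubePoint j 0 q = collinearPoint j q.1 := by
  simp only [tubePoint, collinearPoint, zero_mul, neg_zero]
  rfl

theorem continuous_tubePoint : Continuous fun x :
    ℝ × ((ℂ × ({i : Fin n // i ≠ j} → ℝ)) × ({i : Fin n // i ≠ j} → ℝ)) =>
      tubePoint j x.1 x.2 := by
  refine continuous_framePoint.comp (.prodMk (by fun_prop) (continuous_pi fun i => ?_))
  exact Complex.equivRealProdCLM.symm.continuous.comp (by fun_prop : Continuous fun x :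
    ℝ × ((ℂ × ({i : Fin n // i ≠ j} → ℝ)) × ({i : Fin n // i ≠ j} → ℝ)) =>
      (x.2.1.2 i, -(x.1 * |x.2.1.2 i| * x.2.2 i)))

theorem sinArgDiff_tubePoint (ε : ℝ) {q : ℂ × ({i : Fin n // i ≠ j} → ℝ)}
    (hq : q.1 ≠ 0 ∧ ∀ i, q.2 i ≠ 0) (σ : {i : Fin n // i ≠ j} → ℝ) :
    sinArgDiff j (tubePoint j ε (q, σ)) = ε • tubeSine ε σ := by
  funext i
  have hi : |q.2 i| ≠ 0 := abs_ne_zero.2 (hq.2 i)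
  rw [tubePoint, sinArgDiff_framePoint hq.1 fun h => hq.2 i (congrArg Complex.re h)]
  have hnorm : ‖(⟨q.2 i, -(ε * |q.2 i| * σ i)⟩ : ℂ)‖ = |q.2 i| * √(1 + ε ^ 2 * σ i ^ 2) := by
    rw [Complex.norm_eq_sqrt_sq_add_sq, ← Real.sqrt_sq_eq_abs, ← Real.sqrt_mul (sq_nonneg _)]
    congr 1
    rw [Real.sqrt_sq_eq_abs, neg_sq, mul_pow, mul_pow, sq_abs]
    ring
  rw [hnorm, Pi.smul_apply, smul_eq_mul, tubeSine]
  field_simp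

theorem smul_map_tubePoint {ε : ℝ} (hε : 0 < ε) :
    ENNReal.ofReal (ε ^ Fintype.card {i : Fin n // i ≠ j}) •
      ((collinearMeasure {i : Fin n // i ≠ j}).prod volume).map (tubePoint j ε) = volume := by
  have htube : Measurable (tubePoint j ε) :=
    (continuous_tubePoint.comp (Continuous.prodMk_right ε)).measurable
  refine Measure.ext_of_lintegral _ fun h hh => ?_
  have hm : Measurable fun q => h (tubePoint j ε q) := hh.comp htube
  have hσ : Measurable fun q : ℂ × ({i : Fin n // i ≠ j} → ℝ) =>
      ∫⁻ σ : {i : Fin n // i ≠ j} → ℝ, h (tubePoint j ε (q, σ)) :=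
    hm.lintegral_prod_right'
  rw [lintegral_smul_measure, lintegral_map hh htube,
    lintegral_prod _ hm.aemeasurable, lintegral_collinearMeasure hσ, smul_eq_mul,
    ← lintegral_const_mul' _ _ ENNReal.ofReal_ne_top, lintegral_eq_lintegral_framePoint (j := j) hh]
  refine lintegral_congr fun p => ?_
  rw [lintegral_complex_pi_eq hε (h := fun w => h (framePoint j (p, w)))
    (hh.comp (continuous_framePoint.comp (Continuous.prodMk_right p)).measurable), mul_left_comm]
  rfl

theorem exists_norm_le_of_tubePoint_mem {K : Set ((Fin n → ℝ) × (Fin n → ℝ))} (hK : IsCompact K)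
    (hKΩ : K ⊆ pairsNonzero n) : ∃ R, ∀ ε q, tubePoint j ε q ∈ K → ‖q.1‖ ≤ R := by
  obtain ⟨R, hR⟩ := exists_norm_le_of_framePoint_mem (j := j) hK hKΩ
  refine ⟨R, fun ε q hq => ?_⟩
  have hframe := hR _ hq
  have hR0 := (norm_nonneg _).trans hframe
  refine max_le ((le_max_left _ _).trans hframe) ((pi_norm_le_iff_of_nonneg hR0).2 fun i => ?_)
  exact (Complex.abs_re_le_norm _).trans
    ((norm_le_pi_norm _ i).trans ((le_max_right _ _).trans hframe))

theorem deltaMeasure_lt_top_of_isCompact {K : Set ((Fin n → ℝ) × (Fin n → ℝ))} (hK : IsCompact K)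
    (hKΩ : K ⊆ pairsNonzero n) : deltaMeasure j K < ⊤ := by
  obtain ⟨R, hR⟩ := exists_norm_le_of_tubePoint_mem (j := j) hK hKΩ
  rw [deltaMeasure, Measure.map_apply continuous_collinearPoint.measurable hK.measurableSet]
  refine (measure_mono fun q hq => mem_closedBall_zero_iff.2 (hR 0 (q, 0) ?_)).trans_lt
    (isCompact_closedBall (0 : ℂ × ({i : Fin n // i ≠ j} → ℝ)) R).measure_lt_top
  rwa [tubePoint_zero]

end DeltaMeasure

section DeltaLimit

variable {n : ℕ} {j : Fin n} {ρ : ({i : Fin n // i ≠ j} → ℝ) → ℝ}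
  {φ : (Fin n → ℝ) × (Fin n → ℝ) → ℝ}

theorem integral_sinArgDiff_rescaled (hρ : Continuous ρ) (hφ : Continuous φ) {ε : ℝ} (hε : 0 < ε) :
    ∫ y, ((ε ^ Fintype.card {i : Fin n // i ≠ j})⁻¹ * ρ (ε⁻¹ • sinArgDiff j y)) * φ y =
      ∫ q, ρ (tubeSine ε q.2) * φ (tubePoint j ε q)
        ∂(collinearMeasure {i : Fin n // i ≠ j}).prod volume := by
  have htube : Measurable (tubePoint j ε) :=
    (continuous_tubePoint.comp (Continuous.prodMk_right ε)).measurable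
  have hF : Measurable fun y =>
      ((ε ^ Fintype.card {i : Fin n // i ≠ j})⁻¹ * ρ (ε⁻¹ • sinArgDiff j y)) * φ y :=
    (measurable_const.mul (hρ.measurable.comp ((measurable_sinArgDiff j).const_smul ε⁻¹))).mul
      hφ.measurable
  have hεm : 0 < ε ^ Fintype.card {i : Fin n // i ≠ j} := pow_pos hε _
  conv_lhs => rw [← smul_map_tubePoint (j := j) hε]
  rw [integral_smul_measure, integral_map htube.aemeasurable hF.aestronglyMeasurable,
    ENNReal.toReal_ofReal hεm.le, ← integral_smul]
  refine integral_congr_ae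
    ((Measure.quasiMeasurePreserving_fst.ae ae_collinearMeasure_ne_zero).mono fun q hq => ?_)
  dsimp only
  rw [sinArgDiff_tubePoint ε hq q.2, inv_smul_smul₀ hε.ne', smul_eq_mul, mul_assoc,
    mul_inv_cancel_left₀ hεm.ne']

theorem exists_norm_le_of_tubeSine_mul_tubePoint_ne_zero (hρc : HasCompactSupport ρ)
    (hφc : HasCompactSupport φ) (hφΩ : tsupport φ ⊆ pairsNonzero n) :
    ∃ N, ∀ᶠ ε in 𝓝[>] (0 : ℝ), ∀ q, ρ (tubeSine ε q.2) * φ (tubePoint j ε q) ≠ 0 → ‖q‖ ≤ N := by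
  obtain ⟨M, hM⟩ := exists_norm_le_of_tubePoint_mem (j := j) hφc.isCompact hφΩ
  obtain ⟨R, hR⟩ := hρc.isCompact.isBounded.exists_norm_le
  have hεR : ∀ᶠ ε : ℝ in 𝓝[>] 0, ε * R ≤ 1 / 2 := by
    have hlim : Tendsto (fun ε : ℝ => ε * R) (𝓝[>] 0) (𝓝 (0 * R)) :=
      tendsto_nhdsWithin_of_tendsto_nhds (tendsto_id.mul_const R)
    exact hlim.eventually_le_const (by norm_num)
  refine ⟨max M (2 * R), ?_⟩
  filter_upwards [hεR, self_mem_nhdsWithin] with ε hεR hε q hq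
  have hφq := subset_tsupport _ (right_ne_zero_of_mul hq)
  have hρq := subset_tsupport _ (left_ne_zero_of_mul hq)
  exact max_le_max (hM ε q hφq)
    (norm_le_two_mul_of_norm_tubeSine_le (le_of_lt hε) hεR (hR _ hρq))

theorem tendsto_integral_tubeSine_mul_tubePoint (hρ : Continuous ρ) (hρc : HasCompactSupport ρ)
    (hφ : Continuous φ) (hφc : HasCompactSupport φ) (hφΩ : tsupport φ ⊆ pairsNonzero n) :
    Tendsto (fun ε : ℝ => ∫ q, ρ (tubeSine ε q.2) * φ (tubePoint j ε q)
        ∂(collinearMeasure {i : Fin n // i ≠ j}).prod volume) (𝓝[>] 0)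
      (𝓝 (∫ q, ρ (tubeSine 0 q.2) * φ (tubePoint j 0 q)
        ∂(collinearMeasure {i : Fin n // i ≠ j}).prod volume)) := by
  obtain ⟨N, hN⟩ := exists_norm_le_of_tubeSine_mul_tubePoint_ne_zero hρc hφc hφΩ
  obtain ⟨A, hA⟩ := hρ.bounded_above_of_compact_support hρc
  obtain ⟨B, hB⟩ := hφ.bounded_above_of_compact_support hφc
  have hF : Continuous fun x : ℝ × ((ℂ × ({i : Fin n // i ≠ j} → ℝ)) ×
      ({i : Fin n // i ≠ j} → ℝ)) => ρ (tubeSine x.1 x.2.2) * φ (tubePoint j x.1 x.2) :=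
    (hρ.comp (continuous_tubeSine.comp (continuous_fst.prodMk continuous_snd.snd))).mul
      (hφ.comp continuous_tubePoint)
  refine tendsto_integral_filter_of_dominated_convergence
    ((Metric.closedBall 0 N).indicator fun _ => A * B) ?_ ?_ ?_ ?_
  · exact .of_forall fun ε => (hF.comp (Continuous.prodMk_right ε)).aestronglyMeasurable
  · filter_upwards [hN] with ε hε
    refine .of_forall fun q => ?_
    by_cases hq : ρ (tubeSine ε q.2) * φ (tubePoint j ε q) = 0
    · have hAB : 0 ≤ A * B := mul_nonneg ((norm_nonneg _).trans (hA 0))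
        ((norm_nonneg _).trans (hB 0))
      rw [hq, norm_zero]
      exact Set.indicator_nonneg (fun _ _ => hAB) q
    · rw [Set.indicator_of_mem (mem_closedBall_zero_iff.2 (hε q hq)), norm_mul]
      exact mul_le_mul (hA _) (hB _) (norm_nonneg _) ((norm_nonneg _).trans (hA 0))
  · exact (integrable_indicator_iff measurableSet_closedBall).2
      (integrableOn_const (isCompact_closedBall 0 N).measure_lt_top.ne)
  · refine .of_forall fun q => tendsto_nhdsWithin_of_tendsto_nhds ?_
    exact (hF.comp (Continuous.prodMk_left q)).tendsto 0

theorem isDeltaComp_deltaMeasure (j : Fin n) :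
    IsDeltaComp (pairsNonzero n) (sinArgDiff j) (deltaMeasure j) where
  compl_null := deltaMeasure_compl_pairsNonzero
  finite_on_compacts _ hK hKΩ := deltaMeasure_lt_top_of_isCompact hK hKΩ
  tendsto ρ hρ hρc hρ1 φ hφ hφc hφΩ := by
    have hlim : ∫ q, ρ (tubeSine 0 q.2) * φ (tubePoint j 0 q)
        ∂(collinearMeasure {i : Fin n // i ≠ j}).prod volume = ∫ y, φ y ∂deltaMeasure j := by
      simp only [tubeSine_zero, tubePoint_zero, mul_comm (ρ _)]
      rw [integral_prod_mul (fun q => φ (collinearPoint j q)) ρ, hρ1, mul_one, deltaMeasure,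
        integral_map continuous_collinearPoint.aemeasurable hφ.aestronglyMeasurable]
    rw [← hlim]
    refine (tendsto_integral_tubeSine_mul_tubePoint hρ hρc hφ hφc hφΩ).congr' ?_
    filter_upwards [self_mem_nhdsWithin] with ε hε
    exact (integral_sinArgDiff_rescaled hρ hφ hε).symm

end DeltaLimit

section KernelDensity

variable {n : ℕ} {j : Fin n}

theorem card_subtype_ne (j : Fin n) : Fintype.card {i : Fin n // i ≠ j} = n - 1 := by
  simp [Fintype.card_subtype_compl]

theorem measurable_kernelWeight : Measurable (kernelWeight j) := by
  have hnorm (i : Fin n) : Measurable fun y : (Fin n → ℝ) × (Fin n → ℝ) => pairNorm y i := by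
    unfold pairNorm
    fun_prop
  have hdiff : Measurable fun y : (Fin n → ℝ) × (Fin n → ℝ) => |y.1 j - y.2 j| :=
    (by fun_prop : Continuous fun y : (Fin n → ℝ) × (Fin n → ℝ) => |y.1 j - y.2 j|).measurable
  exact (hdiff.pow_const _).div (((hnorm j).pow_const _).mul
    (Finset.measurable_fun_prod _ fun i _ => hnorm i))

theorem kernelWeight_nonneg (y : (Fin n → ℝ) × (Fin n → ℝ)) : 0 ≤ kernelWeight j y :=
  div_nonneg (zpow_nonneg (abs_nonneg _) _) (mul_nonneg (pow_nonneg (Real.sqrt_nonneg _) _)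
    (Finset.prod_nonneg fun _ _ => Real.sqrt_nonneg _))

theorem kernelWeight_collinearPoint (p : ℂ) (τ : {i : Fin n // i ≠ j} → ℝ) :
    kernelWeight j (collinearPoint j (p, τ)) =
      |p.re - p.im| ^ ((n : ℤ) - 2) / (‖p‖ ^ (2 * (n - 1)) * ∏ i, |τ i|) := by
  have hprod := Finset.prod_subtype (p := fun i => i ≠ j) (F := inferInstance)
    (Finset.univ.erase j) (by simp) (pairNorm (collinearPoint j (p, τ)))
  have hpair (i : {i : Fin n // i ≠ j}) : pairNorm (collinearPoint j (p, τ)) i = ‖p‖ * |τ i| := by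
    simp [collinearPoint, framePoint, pairNorm_complexPairs, i.2]
  have hself : pairNorm (collinearPoint j (p, τ)) j = ‖p‖ := by
    simp [collinearPoint, framePoint, pairNorm_complexPairs]
  rw [kernelWeight, hprod, hself]
  simp only [hpair, Finset.prod_mul_distrib, Finset.prod_const, Finset.card_univ, card_subtype_ne]
  rw [← mul_assoc, two_mul, pow_add]
  simp [collinearPoint, framePoint, complexPairs]

theorem lintegral_withDensity_kernelWeight_deltaMeasure
    {h : (Fin n → ℝ) × (Fin n → ℝ) → ℝ≥0∞} (hh : Measurable h) :
    ∫⁻ y, h y ∂(deltaMeasure j).withDensity (fun y => ENNReal.ofReal (kernelWeight j y)) =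
      ∫⁻ p : ℂ, ENNReal.ofReal (|p.re - p.im| ^ ((n : ℤ) - 2)) *
        ∫⁻ τ, h (collinearPoint j (p, τ)) := by
  have hK : Measurable fun y => ENNReal.ofReal (kernelWeight j y) :=
    measurable_kernelWeight.ennreal_ofReal
  have hm : Measurable fun q => ENNReal.ofReal (kernelWeight j (collinearPoint j q)) *
      h (collinearPoint j q) := (hK.mul hh).comp continuous_collinearPoint.measurable
  rw [lintegral_withDensity_eq_lintegral_mul _ hK hh, deltaMeasure,
    lintegral_map (hK.mul hh) continuous_collinearPoint.measurable]
  simp only [Pi.mul_apply]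
  rw [lintegral_collinearMeasure hm]
  refine lintegral_congr_ae ((Measure.ae_ne volume (0 : ℂ)).mono fun p hp => ?_)
  dsimp only
  rw [← lintegral_const_mul' _ _ ENNReal.ofReal_ne_top,
    ← lintegral_const_mul' _ _ ENNReal.ofReal_ne_top]
  refine lintegral_congr_ae ((ae_pi_forall_ne _ (0 : ℝ)).mono fun τ hτ => ?_)
  have hτ0 : ∏ i, |τ i| ≠ 0 := Finset.prod_ne_zero_iff.2 fun i _ => abs_ne_zero.2 (hτ i)
  dsimp only
  rw [← mul_assoc, ← mul_assoc, ← ENNReal.ofReal_mul (by positivity),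
    ← ENNReal.ofReal_mul (by positivity), kernelWeight_collinearPoint, card_subtype_ne,
    mul_div_cancel₀ _ (by positivity)]

end KernelDensity

/-- The positive measure by which the normal operator `P* P` acts by convolution: the image of
`|α|⁻ⁿ dα dw` under `(α, w) ↦ ((1 - 1/α) w, w)`. -/
noncomputable def normalMeasure (n : ℕ) : Measure ((Fin n → ℝ) × (Fin n → ℝ)) :=
  ((volume : Measure (ℝ × (Fin n → ℝ))).withDensity
    fun q => ENNReal.ofReal (|q.1| ^ n)⁻¹).map fun q => ((1 - q.1⁻¹) • q.2, q.2)

section NormalMeasure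

variable {n : ℕ} {j : Fin n}

theorem measurable_normalMeasure_density :
    Measurable fun q : ℝ × (Fin n → ℝ) => ENNReal.ofReal (|q.1| ^ n)⁻¹ := by
  have habs : Measurable fun q : ℝ × (Fin n → ℝ) => |q.1| :=
    (by fun_prop : Continuous fun q : ℝ × (Fin n → ℝ) => |q.1|).measurable
  exact (habs.pow_const n).inv.ennreal_ofReal

theorem measurable_normalMeasure_map :
    Measurable fun q : ℝ × (Fin n → ℝ) => ((1 - q.1⁻¹) • q.2, q.2) := by
  fun_prop

theorem lintegral_normalMeasure {h : (Fin n → ℝ) × (Fin n → ℝ) → ℝ≥0∞} (hh : Measurable h) :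
    ∫⁻ y, h y ∂normalMeasure n = ∫⁻ α : ℝ, ENNReal.ofReal (|α| ^ n)⁻¹ *
      ∫⁻ w : Fin n → ℝ, h ((1 - α⁻¹) • w, w) := by
  have hm : Measurable fun q : ℝ × (Fin n → ℝ) =>
      ENNReal.ofReal (|q.1| ^ n)⁻¹ * h ((1 - q.1⁻¹) • q.2, q.2) :=
    measurable_normalMeasure_density.mul (hh.comp measurable_normalMeasure_map)
  rw [normalMeasure, lintegral_map_withDensity measurable_normalMeasure_density
    measurable_normalMeasure_map hh, Measure.volume_eq_prod, lintegral_prod _ hm.aemeasurable]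
  exact lintegral_congr fun α => lintegral_const_mul' (ENNReal.ofReal (|α| ^ n)⁻¹)
    (fun w : Fin n → ℝ => h ((1 - α⁻¹) • w, w)) ENNReal.ofReal_ne_top

theorem lintegral_smul_prodMk_eq_lintegral_collinearPoint
    {h : (Fin n → ℝ) × (Fin n → ℝ) → ℝ≥0∞} (hh : Measurable h) (β : ℝ) :
    ∫⁻ w : Fin n → ℝ, h (β • w, w) = ∫⁻ b : ℝ, ENNReal.ofReal (|b| ^ (n - 1)) *
      ∫⁻ τ, h (collinearPoint j (⟨β * b, b⟩, τ)) := by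
  have hslice : Measurable fun w : Fin n → ℝ => h (β • w, w) := hh.comp (by fun_prop)
  have hsplit := measurePreserving_funSplitAt_symm (β := ℝ) j
  have hm := hslice.comp hsplit.measurable
  have hpoint (b : ℝ) (τ : {i : Fin n // i ≠ j} → ℝ) :
      (β • (Equiv.funSplitAt j ℝ).symm (b, b • τ), (Equiv.funSplitAt j ℝ).symm (b, b • τ)) =
        collinearPoint j (⟨β * b, b⟩, τ) := by
    refine Prod.ext (funext fun i => ?_) (funext fun i => ?_) <;> by_cases hi : i = j <;>
      simp [collinearPoint, framePoint, complexPairs, hi, mul_assoc]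
  rw [← hsplit.lintegral_comp hslice, Measure.volume_eq_prod]
  refine (lintegral_prod _ hm.aemeasurable).trans
    (lintegral_congr_ae ((Measure.ae_ne volume (0 : ℝ)).mono fun b hb => ?_))
  simp only [Function.comp_apply]
  rw [lintegral_pi_eq_abs_norm_pow_mul hb (h := fun v => h (β •
    (Equiv.funSplitAt j ℝ).symm (b, v), (Equiv.funSplitAt j ℝ).symm (b, v)))
    (hm.comp measurable_prodMk_left)]
  simp only [hpoint, Algebra.norm_self, MonoidHom.id_apply, card_subtype_ne]

theorem abs_div_sq_mul_zpow {α b : ℝ} (hα : α ≠ 0) (hb : b ≠ 0) (hn : 1 ≤ n) :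
    |b| / α ^ 2 * |(1 - α⁻¹) * b - b| ^ ((n : ℤ) - 2) = (|α| ^ n)⁻¹ * |b| ^ (n - 1) := by
  obtain ⟨m, rfl⟩ := Nat.exists_eq_add_of_le' hn
  have hα' := abs_ne_zero.2 hα
  have hb' := abs_ne_zero.2 hb
  have hdiff : |(1 - α⁻¹) * b - b| = |b| / |α| := by
    rw [sub_mul, one_mul, sub_sub_cancel_left, abs_neg, abs_mul, abs_inv, inv_mul_eq_div]
  have hexp : ((m + 1 : ℕ) : ℤ) - 2 = (m : ℤ) - 1 := by
    push_cast
    ring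
  rw [hdiff, ← sq_abs α, hexp, zpow_sub_one₀ (by positivity), zpow_natCast, Nat.add_sub_cancel,
    div_pow]
  field_simp
  ring

theorem lintegral_normalMeasure_eq_lintegral_collinearPoint (j : Fin n)
    {h : (Fin n → ℝ) × (Fin n → ℝ) → ℝ≥0∞} (hh : Measurable h) :
    ∫⁻ y, h y ∂normalMeasure n = ∫⁻ p : ℂ, ENNReal.ofReal (|p.re - p.im| ^ ((n : ℤ) - 2)) *
      ∫⁻ τ, h (collinearPoint j (p, τ)) := by
  set G : ℂ → ℝ≥0∞ := fun p => ∫⁻ τ, h (collinearPoint j (p, τ))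
  have hG : Measurable G := (hh.comp continuous_collinearPoint.measurable).lintegral_prod_right'
  have hdiff : Measurable fun p : ℂ => |p.re - p.im| :=
    (by fun_prop : Continuous fun p : ℂ => |p.re - p.im|).measurable
  have hm : Measurable fun q : ℝ × ℝ => ENNReal.ofReal (|q.1| ^ n)⁻¹ *
      (ENNReal.ofReal (|q.2| ^ (n - 1)) * G ⟨(1 - q.1⁻¹) * q.2, q.2⟩) := by
    have hmk : Measurable fun q : ℝ × ℝ => (⟨(1 - q.1⁻¹) * q.2, q.2⟩ : ℂ) :=
      Complex.measurableEquivRealProd.symm.measurable.comp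
        (by fun_prop : Measurable fun q : ℝ × ℝ => ((1 - q.1⁻¹) * q.2, q.2))
    exact ((measurable_fst.abs.pow_const n).inv.ennreal_ofReal).mul
      ((measurable_snd.abs.pow_const _).ennreal_ofReal.mul (hG.comp hmk))
  calc ∫⁻ y, h y ∂normalMeasure n
      = ∫⁻ α : ℝ, ∫⁻ b : ℝ, ENNReal.ofReal (|α| ^ n)⁻¹ *
          (ENNReal.ofReal (|b| ^ (n - 1)) * G ⟨(1 - α⁻¹) * b, b⟩) := by
        rw [lintegral_normalMeasure hh]
        refine lintegral_congr fun α => ?_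
        rw [lintegral_smul_prodMk_eq_lintegral_collinearPoint hh,
          lintegral_const_mul' _ _ ENNReal.ofReal_ne_top]
    _ = ∫⁻ b : ℝ, ∫⁻ α : ℝ, ENNReal.ofReal (|α| ^ n)⁻¹ *
          (ENNReal.ofReal (|b| ^ (n - 1)) * G ⟨(1 - α⁻¹) * b, b⟩) :=
        lintegral_lintegral_swap hm.aemeasurable
    _ = ∫⁻ b : ℝ, ∫⁻ a : ℝ, ENNReal.ofReal (|a - b| ^ ((n : ℤ) - 2)) * G ⟨a, b⟩ := by
        refine lintegral_congr_ae ((Measure.ae_ne volume (0 : ℝ)).mono fun b hb => ?_)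
        dsimp only
        rw [lintegral_eq_lintegral_one_sub_inv_mul hb fun a =>
          ENNReal.ofReal (|a - b| ^ ((n : ℤ) - 2)) * G ⟨a, b⟩]
        refine lintegral_congr_ae ((Measure.ae_ne volume (0 : ℝ)).mono fun α hα => ?_)
        dsimp only
        rw [← mul_assoc, ← mul_assoc, ← ENNReal.ofReal_mul (by positivity),
          ← ENNReal.ofReal_mul (by positivity), abs_div_sq_mul_zpow hα hb j.pos]
    _ = _ := (lintegral_complex_eq ((hdiff.pow_const _).ennreal_ofReal.mul hG)).symm

theorem withDensity_kernelWeight_deltaMeasure (j : Fin n) :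
    (deltaMeasure j).withDensity (fun y => ENNReal.ofReal (kernelWeight j y)) = normalMeasure n :=
  Measure.ext_of_lintegral _ fun _ hh => (lintegral_withDensity_kernelWeight_deltaMeasure hh).trans
    (lintegral_normalMeasure_eq_lintegral_collinearPoint j hh).symm

theorem deltaMeasure_fin_one : deltaMeasure (0 : Fin 1) = volume := by
  have : IsEmpty {i : Fin 1 // i ≠ 0} := ⟨fun i => i.2 (Subsingleton.elim _ _)⟩
  exact (isDeltaComp_deltaMeasure 0).unique (isOpen_pairsNonzero 1)
    (isDeltaComp_volume_of_isEmpty (volume_compl_pairsNonzero 1))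

theorem kernelWeight_fin_one :
    kernelWeight (0 : Fin 1) = fun y => |y.1 0 - y.2 0|⁻¹ := by
  funext y
  simp [kernelWeight]

theorem withDensity_inv_abs_sub_volume :
    (volume : Measure ((Fin 1 → ℝ) × (Fin 1 → ℝ))).withDensity
      (fun y => ENNReal.ofReal |y.1 0 - y.2 0|⁻¹) = normalMeasure 1 := by
  rw [← withDensity_kernelWeight_deltaMeasure 0, deltaMeasure_fin_one, kernelWeight_fin_one]

end NormalMeasure

section Decay

theorem one_add_norm_le_mul {E : Type*} [SeminormedAddCommGroup E] (z y : E) :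
    1 + ‖y‖ ≤ (1 + ‖z‖) * (1 + ‖z - y‖) := by
  have : ‖y‖ ≤ ‖z‖ + ‖z - y‖ := by simpa using norm_sub_le z (z - y)
  nlinarith [norm_nonneg z, norm_nonneg (z - y)]

theorem isBigO_one_add_norm_comp_sub {E F : Type*} [SeminormedAddCommGroup E] [Norm F]
    {f : E → F} {r : ℝ} (hr : 0 ≤ r) (hf : f =O[⊤] fun y => (1 + ‖y‖) ^ (-r)) (z : E) :
    (fun y => f (z - y)) =O[⊤] fun y => (1 + ‖y‖) ^ (-r) := by
  refine (hf.comp_tendsto (k := fun y => z - y) tendsto_top).trans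
    (isBigO_top.2 ⟨(1 + ‖z‖) ^ r, fun y => ?_⟩)
  rw [Function.comp_apply, Real.norm_of_nonneg (by positivity), Real.norm_of_nonneg (by positivity),
    Real.rpow_neg (by positivity), Real.rpow_neg (by positivity), ← div_eq_mul_inv,
    inv_le_iff_one_le_mul₀ (by positivity), div_mul_eq_mul_div, one_le_div (by positivity),
    ← Real.mul_rpow (by positivity) (by positivity)]
  exact Real.rpow_le_rpow (by positivity) (one_add_norm_le_mul z y) hr

theorem isBigO_one_add_norm_of_schwartz {E F : Type*} [NormedAddCommGroup E] [NormedSpace ℝ E]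
    [NormedAddCommGroup F] [NormedSpace ℝ F] (f : 𝓢(E, F)) (k : ℕ) :
    f =O[⊤] fun y => (1 + ‖y‖) ^ (-(k : ℝ)) := by
  refine isBigO_top.2 ⟨2 ^ k * (Finset.Iic (k, 0)).sup (schwartzSeminormFamily ℝ E F) f,
    fun y => ?_⟩
  have hy := SchwartzMap.one_add_le_sup_seminorm_apply (𝕜 := ℝ) (m := (k, 0)) le_rfl le_rfl f y
  rw [norm_iteratedFDeriv_zero, mul_comm] at hy
  rwa [Real.rpow_neg (by positivity), Real.rpow_natCast, norm_inv,
    Real.norm_of_nonneg (by positivity), ← div_eq_mul_inv, le_div_iff₀ (by positivity)]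

theorem norm_smul_prodMk_self {E : Type*} [SeminormedAddCommGroup E] [NormedSpace ℝ E] (β : ℝ)
    (w : E) : ‖(β • w, w)‖ = ‖max |β| 1 • w‖ := by
  rw [Prod.norm_def, norm_smul, norm_smul, Real.norm_eq_abs,
    Real.norm_of_nonneg (zero_le_one.trans (le_max_right _ _)),
    max_mul_of_nonneg _ _ (norm_nonneg w), one_mul]

theorem one_add_abs_le_three_mul {α : ℝ} (hα : α ≠ 0) :
    1 + |α| ≤ 3 * (|α| * max |1 - α⁻¹| 1) := by
  rw [mul_max_of_nonneg _ _ (abs_nonneg α), ← abs_mul, mul_sub, mul_inv_cancel₀ hα, mul_one,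
    mul_one]
  rcases le_total (1 / 2) |α| with h | h
  · linarith [le_max_right |α - 1| |α|]
  · have := abs_sub_abs_le_abs_sub 1 α
    rw [abs_one, abs_sub_comm] at this
    linarith [le_max_left |α - 1| |α|]

variable {n : ℕ} {r : ℝ}

theorem integrable_comp_sub_smul_prodMk {F : Type*} [NormedAddCommGroup F]
    {f : (Fin n → ℝ) × (Fin n → ℝ) → F} (hfm : StronglyMeasurable f) (hr : n < r)
    (hf : f =O[⊤] fun y => (1 + ‖y‖) ^ (-r)) (z : (Fin n → ℝ) × (Fin n → ℝ)) (β : ℝ) :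
    Integrable fun w : Fin n → ℝ => f (z - (β • w, w)) := by
  have hr0 : 0 ≤ r := n.cast_nonneg.trans hr.le
  have hslice : (fun w : Fin n → ℝ => f (z - (β • w, w))) =O[⊤]
      fun w : Fin n → ℝ => (1 + ‖w‖) ^ (-r) := by
    refine ((isBigO_one_add_norm_comp_sub hr0 hf z).comp_tendsto
      (k := fun w : Fin n → ℝ => (β • w, w)) tendsto_top).trans
      (isBigO_of_le _ fun w => ?_)
    rw [Function.comp_apply, Real.norm_of_nonneg (by positivity),
      Real.norm_of_nonneg (by positivity)]
    exact Real.rpow_le_rpow_of_nonpos (by positivity)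
      (by gcongr; exact norm_snd_le (β • w, w)) (neg_nonpos.2 hr0)
  exact hslice.integrable (hfm.comp_measurable (by fun_prop)).aestronglyMeasurable
    (integrable_one_add_norm (by simpa using hr))

theorem ofReal_inv_pow_mul_lintegral_one_add_norm_le {α : ℝ} (hα : α ≠ 0) (r : ℝ) :
    ENNReal.ofReal (|α| ^ n)⁻¹ * ∫⁻ w : Fin n → ℝ,
        ENNReal.ofReal ((1 + ‖((1 - α⁻¹) • w, w)‖) ^ (-r)) ≤
      ENNReal.ofReal (3 ^ n * (1 + ‖α‖) ^ (-(n : ℝ))) *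
        ∫⁻ w : Fin n → ℝ, ENNReal.ofReal ((1 + ‖w‖) ^ (-r)) := by
  set b := max |1 - α⁻¹| 1
  have hb : 0 < b := lt_max_of_lt_right one_pos
  have hα' : 0 < |α| := abs_pos.2 hα
  have hscale : ∫⁻ w : Fin n → ℝ, ENNReal.ofReal ((1 + ‖w‖) ^ (-r)) = ENNReal.ofReal (b ^ n) *
      ∫⁻ w : Fin n → ℝ, ENNReal.ofReal ((1 + ‖b • w‖) ^ (-r)) := by
    rw [lintegral_pi_eq_abs_norm_pow_mul hb.ne'
      (h := fun w : Fin n → ℝ => ENNReal.ofReal ((1 + ‖w‖) ^ (-r))) (by fun_prop)]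
    simp only [Algebra.norm_self, MonoidHom.id_apply, Fintype.card_fin, abs_of_pos hb]
  simp only [norm_smul_prodMk_self]
  rw [hscale, ← mul_assoc, ← ENNReal.ofReal_mul (by positivity)]
  gcongr
  rw [Real.rpow_neg (by positivity), Real.rpow_natCast, ← div_eq_mul_inv, div_mul_eq_mul_div,
    ← mul_pow, ← div_pow, Real.norm_eq_abs, ← inv_pow]
  refine pow_le_pow_left₀ (by positivity) ?_ n
  rw [inv_le_iff_one_le_mul₀ hα', div_mul_eq_mul_div, one_le_div (by positivity), mul_assoc,
    mul_comm b]
  exact one_add_abs_le_three_mul hα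

theorem integrable_one_add_norm_normalMeasure (hn : 2 ≤ n) (hr : n < r) :
    Integrable (fun y => (1 + ‖y‖) ^ (-r)) (normalMeasure n) := by
  have hmeas : Measurable fun y : (Fin n → ℝ) × (Fin n → ℝ) => (1 + ‖y‖) ^ (-r) := by fun_prop
  have hw : ∫⁻ w : Fin n → ℝ, ENNReal.ofReal ((1 + ‖w‖) ^ (-r)) < ⊤ :=
    (integrable_one_add_norm (by simpa using hr)).lintegral_lt_top
  have hα : ∫⁻ α : ℝ, ENNReal.ofReal (3 ^ n * (1 + ‖α‖) ^ (-(n : ℝ))) < ⊤ := by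
    refine ((integrable_one_add_norm ?_).const_mul _).lintegral_lt_top
    simpa using Nat.lt_of_succ_le hn
  refine ⟨hmeas.aestronglyMeasurable, ?_⟩
  calc ∫⁻ y, ‖(1 + ‖y‖) ^ (-r)‖ₑ ∂normalMeasure n
      = ∫⁻ α : ℝ, ENNReal.ofReal (|α| ^ n)⁻¹ * ∫⁻ w : Fin n → ℝ,
          ENNReal.ofReal ((1 + ‖((1 - α⁻¹) • w, w)‖) ^ (-r)) := by
        rw [← lintegral_normalMeasure hmeas.ennreal_ofReal]
        exact lintegral_congr fun y => Real.enorm_of_nonneg (by positivity)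
    _ ≤ ∫⁻ α : ℝ, ENNReal.ofReal (3 ^ n * (1 + ‖α‖) ^ (-(n : ℝ))) *
          ∫⁻ w : Fin n → ℝ, ENNReal.ofReal ((1 + ‖w‖) ^ (-r)) :=
        lintegral_mono_ae ((Measure.ae_ne volume (0 : ℝ)).mono fun α hα =>
          ofReal_inv_pow_mul_lintegral_one_add_norm_le hα r)
    _ < ⊤ := by
        rw [lintegral_mul_const' _ _ hw.ne]
        exact ENNReal.mul_lt_top hα hw

end Decay

section NormalOperator

variable {n : ℕ} {F : Type*} [NormedAddCommGroup F]
  {f : (Fin n → ℝ) × (Fin n → ℝ) → F} {z : (Fin n → ℝ) × (Fin n → ℝ)}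

theorem integrable_comp_sub_normalMeasure {r : ℝ} (hn : 2 ≤ n) (hfm : StronglyMeasurable f)
    (hr : n < r) (hf : f =O[⊤] fun y => (1 + ‖y‖) ^ (-r)) :
    Integrable (fun y => f (z - y)) (normalMeasure n) :=
  (isBigO_one_add_norm_comp_sub (n.cast_nonneg.trans hr.le) hf z).integrable
    (hfm.comp_measurable (by fun_prop)).aestronglyMeasurable
    (integrable_one_add_norm_normalMeasure hn hr)

theorem photographyTransform_eq_integral_sub [NormedSpace ℝ F] (f : (Fin n → ℝ) × (Fin n → ℝ) → F)
    (z : (Fin n → ℝ) × (Fin n → ℝ)) {α : ℝ} (hα : α ≠ 0) :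
    photographyTransform f α (α • z.1 + (1 - α) • z.2) =
      (|α| ^ n)⁻¹ • ∫ w : Fin n → ℝ, f (z - ((1 - α⁻¹) • w, w)) := by
  have hpoint (w : Fin n → ℝ) : (α⁻¹ • (α • z.1 + (1 - α) • z.2) + (1 - α⁻¹) • (z.2 - w),
      z.2 - w) = z - ((1 - α⁻¹) • w, w) := by
    refine Prod.ext (funext fun i => ?_) rfl
    simp only [Pi.add_apply, Pi.smul_apply, Pi.sub_apply, smul_eq_mul, Prod.fst_sub]
    field_simp
    ring
  rw [photographyTransform, if_neg hα, ← integral_sub_left_eq_self _ volume z.2]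
  simp only [hpoint]

theorem lintegral_photographyTransform_norm (hfm : StronglyMeasurable f)
    (hf : ∀ β : ℝ, Integrable fun w : Fin n → ℝ => f (z - (β • w, w))) :
    ∫⁻ α : ℝ, ‖photographyTransform (fun q => ‖f q‖) α (α • z.1 + (1 - α) • z.2)‖ₑ =
      ∫⁻ y, ‖f (z - y)‖ₑ ∂normalMeasure n := by
  have hsub : StronglyMeasurable fun y => f (z - y) := hfm.comp_measurable (by fun_prop)
  rw [lintegral_normalMeasure hsub.enorm]
  refine lintegral_congr_ae ((Measure.ae_ne volume (0 : ℝ)).mono fun α hα => ?_)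
  dsimp only
  rw [photographyTransform_eq_integral_sub _ _ hα, enorm_smul, Real.enorm_of_nonneg (by positivity),
    Real.enorm_of_nonneg (by positivity), ofReal_integral_norm_eq_lintegral_enorm (hf _)]

theorem photographyTransform_ae_eq_integral_smul [NormedSpace ℝ F]
    (f : (Fin n → ℝ) × (Fin n → ℝ) → F) (z : (Fin n → ℝ) × (Fin n → ℝ)) :
    (fun α : ℝ => photographyTransform f α (α • z.1 + (1 - α) • z.2)) =ᵐ[volume]
      fun α => ∫ w : Fin n → ℝ, (|α| ^ n)⁻¹ • f (z - ((1 - α⁻¹) • w, w)) :=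
  (Measure.ae_ne volume (0 : ℝ)).mono fun _ hα =>
    (photographyTransform_eq_integral_sub f z hα).trans (integral_smul _ _).symm

theorem integrable_smul_of_integrable_normalMeasure [NormedSpace ℝ F]
    {g : (Fin n → ℝ) × (Fin n → ℝ) → F} (hg : Integrable g (normalMeasure n)) :
    Integrable (fun q : ℝ × (Fin n → ℝ) => (|q.1| ^ n)⁻¹ • g ((1 - q.1⁻¹) • q.2, q.2))
      (volume.prod volume) := by
  have hmap := (integrable_map_measure hg.aestronglyMeasurable
    measurable_normalMeasure_map.aemeasurable).1 hg
  have hsmul := (integrable_withDensity_iff_integrable_smul'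
    measurable_normalMeasure_density (by simp)).1 hmap
  simpa only [Measure.volume_eq_prod, Function.comp_apply,
    ENNReal.toReal_ofReal (inv_nonneg.2 (pow_nonneg (abs_nonneg _) n))] using hsmul

theorem integral_normalMeasure [NormedSpace ℝ F] {g : (Fin n → ℝ) × (Fin n → ℝ) → F}
    (hg : Integrable g (normalMeasure n)) :
    ∫ y, g y ∂normalMeasure n =
      ∫ α : ℝ, ∫ w : Fin n → ℝ, (|α| ^ n)⁻¹ • g ((1 - α⁻¹) • w, w) := by
  rw [← integral_prod _ (integrable_smul_of_integrable_normalMeasure hg), normalMeasure,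
    integral_map measurable_normalMeasure_map.aemeasurable hg.aestronglyMeasurable,
    integral_withDensity_eq_integral_toReal_smul measurable_normalMeasure_density (by simp),
    Measure.volume_eq_prod]
  simp only [ENNReal.toReal_ofReal (inv_nonneg.2 (pow_nonneg (abs_nonneg _) n))]

theorem integrable_photographyTransform [NormedSpace ℝ F]
    (hf : Integrable (fun y => f (z - y)) (normalMeasure n)) :
    Integrable fun α : ℝ => photographyTransform f α (α • z.1 + (1 - α) • z.2) :=
  (integrable_smul_of_integrable_normalMeasure hf).integral_prod_left.congr
    (photographyTransform_ae_eq_integral_smul f z).symm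

theorem dualPhotographyTransform_photographyTransform [NormedSpace ℝ F]
    (hf : Integrable (fun y => f (z - y)) (normalMeasure n)) :
    dualPhotographyTransform (photographyTransform f) z = ∫ y, f (z - y) ∂normalMeasure n :=
  (integral_congr_ae (photographyTransform_ae_eq_integral_smul f z)).trans
    (integral_normalMeasure hf).symm

end NormalOperator

section Convolution

theorem lintegral_enorm_withDensity_ofReal {X F : Type*} [MeasurableSpace X] [NormedAddCommGroup F]
    [NormedSpace ℝ F] {μ : Measure X} {K : X → ℝ} {g : X → F} (hK : Measurable K)
    (hK0 : ∀ y, 0 ≤ K y) (hg : StronglyMeasurable g) :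
    ∫⁻ y, ‖g y‖ₑ ∂μ.withDensity (fun y => ENNReal.ofReal (K y)) = ∫⁻ y, ‖K y • g y‖ₑ ∂μ := by
  rw [lintegral_withDensity_eq_lintegral_mul _ hK.ennreal_ofReal hg.enorm]
  refine lintegral_congr fun y => ?_
  rw [enorm_smul, Real.enorm_of_nonneg (hK0 y), Pi.mul_apply]

variable {X F : Type*} [MeasurableSpace X] [AddGroup X] [NormedAddCommGroup F] [NormedSpace ℝ F]
  {μ : Measure X} {K : X → ℝ} {f : X → F} {z : X}

theorem convolutionExistsAt_lsmul_iff_integrable_withDensity (hK : Measurable K)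
    (hK0 : ∀ y, 0 ≤ K y) :
    ConvolutionExistsAt K f z (ContinuousLinearMap.lsmul ℝ ℝ) μ ↔
      Integrable (fun y => f (z - y)) (μ.withDensity fun y => ENNReal.ofReal (K y)) := by
  rw [integrable_withDensity_iff_integrable_smul' hK.ennreal_ofReal (by simp)]
  simp only [ENNReal.toReal_ofReal (hK0 _)]
  rfl

theorem convolution_lsmul_eq_integral_withDensity (hK : Measurable K) (hK0 : ∀ y, 0 ≤ K y) :
    (K ⋆[ContinuousLinearMap.lsmul ℝ ℝ, μ] f) z =
      ∫ y, f (z - y) ∂μ.withDensity fun y => ENNReal.ofReal (K y) := by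
  rw [integral_withDensity_eq_integral_toReal_smul hK.ennreal_ofReal (by simp), convolution_def]
  simp only [ENNReal.toReal_ofReal (hK0 _)]
  rfl

end Convolution

section Kernel

variable {n : ℕ} {F : Type*} [NormedAddCommGroup F] [NormedSpace ℝ F]
  {μ : Measure ((Fin n → ℝ) × (Fin n → ℝ))} {K : (Fin n → ℝ) × (Fin n → ℝ) → ℝ}

theorem normalOperator_eq_convolution (hK : Measurable K) (hK0 : ∀ y, 0 ≤ K y)
    (hμ : μ.withDensity (fun y => ENNReal.ofReal (K y)) = normalMeasure n)
    {f : (Fin n → ℝ) × (Fin n → ℝ) → F} {r : ℝ} (hfm : StronglyMeasurable f) (hr : n < r)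
    (hf : f =O[⊤] fun y => (1 + ‖y‖) ^ (-r)) (z : (Fin n → ℝ) × (Fin n → ℝ)) :
    (∫⁻ α : ℝ, ‖photographyTransform (fun q => ‖f q‖) α (α • z.1 + (1 - α) • z.2)‖ₑ =
      ∫⁻ y, ‖K y • f (z - y)‖ₑ ∂μ) ∧
    (ConvolutionExistsAt K f z (ContinuousLinearMap.lsmul ℝ ℝ) μ →
      Integrable (fun α : ℝ => photographyTransform f α (α • z.1 + (1 - α) • z.2)) ∧
      dualPhotographyTransform (photographyTransform f) z =
        (K ⋆[ContinuousLinearMap.lsmul ℝ ℝ, μ] f) z) ∧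
    (2 ≤ n → ConvolutionExistsAt K f z (ContinuousLinearMap.lsmul ℝ ℝ) μ) := by
  have hsub : StronglyMeasurable fun y => f (z - y) := hfm.comp_measurable (by fun_prop)
  rw [convolutionExistsAt_lsmul_iff_integrable_withDensity hK hK0,
    convolution_lsmul_eq_integral_withDensity hK hK0,
    ← lintegral_enorm_withDensity_ofReal hK hK0 hsub, hμ]
  exact ⟨lintegral_photographyTransform_norm hfm (integrable_comp_sub_smul_prodMk hfm hr hf z),
    fun h => ⟨integrable_photographyTransform h, dualPhotographyTransform_photographyTransform h⟩,
    fun hn => integrable_comp_sub_normalMeasure hn hfm hr hf⟩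

end Kernel

theorem theorem3p8_general {F : Type*} [NormedAddCommGroup F] [NormedSpace ℝ F] :
    (∀ (n : ℕ) (j : Fin n),
      ∃ δ : Measure ((Fin n → ℝ) × (Fin n → ℝ)),
        IsDeltaComp (pairsNonzero n) (sinArgDiff j) δ ∧
        (∀ δ', IsDeltaComp (pairsNonzero n) (sinArgDiff j) δ' → δ' = δ) ∧
        ∀ (f : (Fin n → ℝ) × (Fin n → ℝ) → F) (r : ℝ), StronglyMeasurable f → n < r →
          f =O[⊤] (fun y => (1 + ‖y‖) ^ (-r)) → ∀ z : (Fin n → ℝ) × (Fin n → ℝ),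
          (∫⁻ α : ℝ, ‖photographyTransform (fun q => ‖f q‖) α (α • z.1 + (1 - α) • z.2)‖ₑ
            = ∫⁻ y, ‖kernelWeight j y • f (z - y)‖ₑ ∂δ) ∧
          (ConvolutionExistsAt (kernelWeight j) f z (ContinuousLinearMap.lsmul ℝ ℝ) δ →
            Integrable (fun α : ℝ => photographyTransform f α (α • z.1 + (1 - α) • z.2)) ∧
            dualPhotographyTransform (photographyTransform f) z
              = (kernelWeight j ⋆[ContinuousLinearMap.lsmul ℝ ℝ, δ] f) z) ∧
          (2 ≤ n →
            ConvolutionExistsAt (kernelWeight j) f z (ContinuousLinearMap.lsmul ℝ ℝ) δ)) ∧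
    (∀ (f : (Fin 1 → ℝ) × (Fin 1 → ℝ) → F) (r : ℝ), StronglyMeasurable f → 1 < r →
      f =O[⊤] (fun y => (1 + ‖y‖) ^ (-r)) → ∀ z : (Fin 1 → ℝ) × (Fin 1 → ℝ),
      (∫⁻ α : ℝ, ‖photographyTransform (fun q => ‖f q‖) α (α • z.1 + (1 - α) • z.2)‖ₑ
        = ∫⁻ y : (Fin 1 → ℝ) × (Fin 1 → ℝ), ‖|y.1 0 - y.2 0|⁻¹ • f (z - y)‖ₑ) ∧
      (ConvolutionExistsAt (fun y : (Fin 1 → ℝ) × (Fin 1 → ℝ) => |y.1 0 - y.2 0|⁻¹) f z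
          (ContinuousLinearMap.lsmul ℝ ℝ) volume →
        Integrable (fun α : ℝ => photographyTransform f α (α • z.1 + (1 - α) • z.2)) ∧
        dualPhotographyTransform (photographyTransform f) z
          = ((fun y : (Fin 1 → ℝ) × (Fin 1 → ℝ) => |y.1 0 - y.2 0|⁻¹)
              ⋆[ContinuousLinearMap.lsmul ℝ ℝ, volume] f) z)) := by
  refine ⟨fun n j => ⟨deltaMeasure j, isDeltaComp_deltaMeasure j,
    fun δ' hδ' => hδ'.unique (isOpen_pairsNonzero n) (isDeltaComp_deltaMeasure j),
    fun f r hfm hr hf => normalOperator_eq_convolution measurable_kernelWeight kernelWeight_nonneg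
      (withDensity_kernelWeight_deltaMeasure j) hfm hr hf⟩, fun f r hfm hr hf z => ?_⟩
  obtain ⟨habs, hdual, -⟩ := normalOperator_eq_convolution
    (kernelWeight_fin_one ▸ measurable_kernelWeight) (fun y => by positivity)
    withDensity_inv_abs_sub_volume hfm (by exact_mod_cast hr) hf z
  exact ⟨habs, hdual⟩

theorem theorem3p8 :
    (∀ (n : ℕ) (j : Fin n),
      ∃ δ : Measure ((Fin n → ℝ) × (Fin n → ℝ)),
        -- `δ` is the measure `∏_{i ≠ j} δ(sin(φⱼ - φᵢ))`, and it is the only one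
        IsDeltaComp (pairsNonzero n) (sinArgDiff j) δ ∧
        (∀ δ', IsDeltaComp (pairsNonzero n) (sinArgDiff j) δ' → δ' = δ) ∧
        ∀ (f : 𝓢((Fin n → ℝ) × (Fin n → ℝ), ℂ)) (z : (Fin n → ℝ) × (Fin n → ℝ)),
          -- the identity for `|f|`, between values in `[0, ∞]`
          (∫⁻ α : ℝ, ‖photographyTransform (fun q => ‖f q‖) α (α • z.1 + (1 - α) • z.2)‖ₑ
            = ∫⁻ y, ‖kernelWeight j y • f (z - y)‖ₑ ∂δ) ∧
          -- the identity for `f`, where the convolution converges absolutely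
          (ConvolutionExistsAt (kernelWeight j) f z (ContinuousLinearMap.lsmul ℝ ℝ) δ →
            Integrable (fun α : ℝ => photographyTransform f α (α • z.1 + (1 - α) • z.2)) ∧
            dualPhotographyTransform (photographyTransform f) z
              = (kernelWeight j ⋆[ContinuousLinearMap.lsmul ℝ ℝ, δ] f) z) ∧
          -- which is everywhere if `n ≥ 2`
          (2 ≤ n →
            ConvolutionExistsAt (kernelWeight j) f z (ContinuousLinearMap.lsmul ℝ ℝ) δ)) ∧
    -- the case `n = 1`
    (∀ (f : 𝓢((Fin 1 → ℝ) × (Fin 1 → ℝ), ℂ)) (z : (Fin 1 → ℝ) × (Fin 1 → ℝ)),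
      (∫⁻ α : ℝ, ‖photographyTransform (fun q => ‖f q‖) α (α • z.1 + (1 - α) • z.2)‖ₑ
        = ∫⁻ y : (Fin 1 → ℝ) × (Fin 1 → ℝ), ‖|y.1 0 - y.2 0|⁻¹ • f (z - y)‖ₑ) ∧
      (ConvolutionExistsAt (fun y : (Fin 1 → ℝ) × (Fin 1 → ℝ) => |y.1 0 - y.2 0|⁻¹) f z
          (ContinuousLinearMap.lsmul ℝ ℝ) volume →
        Integrable (fun α : ℝ => photographyTransform f α (α • z.1 + (1 - α) • z.2)) ∧
        dualPhotographyTransform (photographyTransform f) z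
          = ((fun y : (Fin 1 → ℝ) × (Fin 1 → ℝ) => |y.1 0 - y.2 0|⁻¹)
              ⋆[ContinuousLinearMap.lsmul ℝ ℝ, volume] f) z)) := by
  have hdecay (n : ℕ) (f : 𝓢((Fin n → ℝ) × (Fin n → ℝ), ℂ)) :
      f =O[⊤] fun y => (1 + ‖y‖) ^ (-((n + 1 : ℕ) : ℝ)) := isBigO_one_add_norm_of_schwartz f (n + 1)
  refine ⟨fun n j => ?_, fun f => theorem3p8_general.2 f _ f.continuous.stronglyMeasurable
    (by norm_num) (hdecay 1 f)⟩
  obtain ⟨δ, hδ, hunique, hconv⟩ := (theorem3p8_general (F := ℂ)).1 n j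
  exact ⟨δ, hδ, hunique, fun f => hconv f _ f.continuous.stronglyMeasurable
    (Nat.cast_lt.2 n.lt_succ_self) (hdecay n f)⟩
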